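/- Let $S^n=\{x\in\mathbb R^{n+1} : \|x\|=1\}$ with the geodesic metric $d_{S^n}(x,y)=\arccos\langle x,y\rangle$ and the antipodal involution $x\mapsto -x$, and let $\mathbb{RP}^n=S^n/(x\sim -x)$ with the quotient metric $d(\{\pm x\},\{\pm y\})=\min(d_{S^n}(x,y),d_{S^n}(x,-y))$. For a metric space $X$ and $r\ge 0$, let $\mathrm{VR}(X;r)$ be the Vietoris–Rips simplicial complex, whose vertex set is $X$ and whose simplices are the nonempty finite subsets of $X$ of diameter at most $r$, identified with its geometric realization (with the usual weak topology). The antipodal map of $S^n$ extends to an involution of $\mathrm{VR}(S^n;r)$ by $-\left(\sum_i\lambda_i x_i\right)=\sum_i\lambda_i(-x_i)$, and a continuous map $f$ is called odd if $f(-x)=-f(x)$ for all $x$. Put $$c_{n,k}=\inf\{r\ge 0 : \text{there exists an odd continuous map } S^k\to \mathrm{VR}(S^n;r)\}.$$ For a metric space $X$, let $\mathrm{cov}_X(k)$ be the infimum of all $\varepsilon>0$ such that there is a finite set $A\subseteq X$ with $|A|\le k$ for which the open balls of radius $\varepsilon$ about the points of $A$ cover $X$. **Theorem.** For all integers $k\ge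 n\ge 1$, $$c_{n,k}\ \ge\ \pi-2\,\mathrm{cov}_{\mathbb{RP}^n}(k).$$ Consequently, for every $n\ge 1$, $\lim_{k\to\infty}c_{n,k}=\pi$. -/

import Mathlib

open Filter Topology

noncomputable section

/-! ### Geometric realizations of abstract simplicial complexes -/

/-- The points of the geometric realization of `K`: formal convex combinations `∑ λᵢ xᵢ` of
vertices, recorded by their barycentric coordinates, whose support is a face of `K`. -/
def GeometricRealization {V : Type*} (K : PreAbstractSimplicialComplex V) : Type _ :=
  {p : V →₀ ℝ // (∀ v, 0 ≤ p v) ∧ (p.sum fun _ a => a) = 1 ∧ p.support ∈ K.faces}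

namespace GeometricRealization

variable {V : Type*} {K : PreAbstractSimplicialComplex V}

/-- The barycentric coordinate of the point `p` at the vertex `v`. -/
def coord (p : GeometricRealization K) (v : V) : ℝ := p.1 v

/-- The closed geometric simplex spanned by the finite vertex set `σ`. -/
def ClosedSimplex (K : PreAbstractSimplicialComplex V) (σ : Finset V) : Type _ :=
  {p : GeometricRealization K // p.1.support ⊆ σ}

/-- A closed simplex carries the Euclidean topology of its (finitely many nonzero)
barycentric coordinates. -/
instance (σ : Finset V) : TopologicalSpace (ClosedSimplex K σ) :=
  TopologicalSpace.induced (fun p v => p.1.coord v : ClosedSimplex K σ → V → ℝ) inferInstance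

/-- The usual (weak, or coherent) topology of a simplicial complex: a set is open if and only if
its intersection with every closed simplex is open in that simplex. -/
instance : TopologicalSpace (GeometricRealization K) :=
  ⨆ σ ∈ K.faces, TopologicalSpace.coinduced
    (fun p : ClosedSimplex K σ => p.1) inferInstance

theorem isOpen_iff {U : Set (GeometricRealization K)} :
    IsOpen U ↔ ∀ σ ∈ K.faces, IsOpen {p : ClosedSimplex K σ | p.1 ∈ U} := by
  simp only [isOpen_iSup_iff, isOpen_coinduced]
  rfl

end GeometricRealization

/-! ### Vietoris–Rips complexes -/

/-- The Vietoris–Rips complex: the simplices are the nonempty finite sets of diameter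
at most `r`. -/
def vietorisRips (X : Type*) [PseudoMetricSpace X] (r : ℝ) : PreAbstractSimplicialComplex X where
  faces := {σ | σ.Nonempty ∧ Metric.diam (σ : Set X) ≤ r}
  isRelLowerSet_faces := by
    rintro σ ⟨hne, hd⟩
    refine ⟨hne, fun τ hτ hτne => ⟨hτne, le_trans ?_ hd⟩⟩
    exact Metric.diam_mono (by exact_mod_cast hτ) σ.finite_toSet.isBounded

/-- A `ℤ/2` metric space: a metric space with an isometric involution `x ↦ -x`. -/
class Z2MetricSpace (X : Type*) [PseudoMetricSpace X] [InvolutiveNeg X] : Prop where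
  dist_neg_neg : ∀ x y : X, dist (-x) (-y) = dist x y

/-- The involution `-(∑ λᵢ xᵢ) = ∑ λᵢ (-xᵢ)` on the Vietoris–Rips complex of a `ℤ/2` metric
space. -/
instance {X : Type*} [PseudoMetricSpace X] [InvolutiveNeg X] [Z2MetricSpace X] {r : ℝ} :
    Neg (GeometricRealization (vietorisRips X r)) where
  neg p := ⟨p.1.mapDomain (fun x => -x), by
    classical
    obtain ⟨p, h0, h1, hne, hd⟩ := p
    have hs : (p.mapDomain (fun x => -x)).support = p.support.image (fun x => -x) :=
      Finsupp.mapDomain_support_of_injective neg_injective p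
    refine ⟨fun v => ?_, ?_, ?_, ?_⟩
    · have := Finsupp.mapDomain_apply (neg_injective : Function.Injective (fun x : X => -x)) p (-v)
      rw [neg_neg] at this
      rw [this]
      exact h0 _
    · rw [Finsupp.sum_mapDomain_index (fun _ => rfl) (fun _ _ _ => rfl)]
      exact h1
    · rw [hs]
      exact hne.image _
    · rw [hs, Finset.coe_image]
      have hi : Isometry (fun x : X => -x) := Isometry.of_dist_eq Z2MetricSpace.dist_neg_neg
      rw [hi.diam_image]
      exact hd⟩

/-! ### Spheres with the geodesic metric -/

/-- The `n`-sphere: the unit sphere of `ℝⁿ⁺¹`. -/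
def UnitSphere (n : ℕ) : Type :=
  Metric.sphere (0 : EuclideanSpace ℝ (Fin (n + 1))) 1

namespace UnitSphere

variable {n : ℕ}

/-- The underlying vector of a point of the sphere. -/
def toVec (x : UnitSphere n) : EuclideanSpace ℝ (Fin (n + 1)) := x.1

theorem norm_toVec (x : UnitSphere n) : ‖x.toVec‖ = 1 := by
  have h := x.2
  rwa [mem_sphere_zero_iff_norm] at h

/-- The antipodal map. -/
instance : InvolutiveNeg (UnitSphere n) :=
  inferInstanceAs (InvolutiveNeg (Metric.sphere (0 : EuclideanSpace ℝ (Fin (n + 1))) 1))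

theorem toVec_neg (x : UnitSphere n) : (-x).toVec = -x.toVec := rfl

/-- The subspace topology. -/
instance : TopologicalSpace (UnitSphere n) :=
  inferInstanceAs (TopologicalSpace (Metric.sphere (0 : EuclideanSpace ℝ (Fin (n + 1))) 1))

theorem continuous_toVec : Continuous (toVec : UnitSphere n → _) := continuous_subtype_val

instance : CompactSpace (UnitSphere n) :=
  inferInstanceAs (CompactSpace (Metric.sphere (0 : EuclideanSpace ℝ (Fin (n + 1))) 1))

/-- The geodesic metric on the sphere. -/
abbrev geodesicMetric (n : ℕ) : MetricSpace (UnitSphere n) where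
  dist x y := InnerProductGeometry.angle x.toVec y.toVec
  dist_self x := InnerProductGeometry.angle_self
    (norm_ne_zero_iff.1 (by rw [x.norm_toVec]; exact one_ne_zero))
  dist_comm x y := InnerProductGeometry.angle_comm _ _
  dist_triangle x y z := InnerProductGeometry.angle_le_angle_add_angle _ _ _
  eq_of_dist_eq_zero := by
    intro x y h
    obtain ⟨-, r, hr, hxy⟩ := InnerProductGeometry.angle_eq_zero_iff.1 h
    have h1 := congrArg norm hxy
    rw [norm_smul, x.norm_toVec, y.norm_toVec, Real.norm_of_nonneg hr.le, mul_one] at h1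
    rw [← h1, one_smul] at hxy
    exact Subtype.ext hxy.symm

theorem eq_induced_of_continuous_equiv {X Y : Type*} [t : TopologicalSpace X]
    [CompactSpace X] [m : MetricSpace Y] (e : X ≃ Y)
    (h : ∀ x, Tendsto (fun y => dist (e y) (e x)) (𝓝 x) (𝓝 0)) :
    t = TopologicalSpace.induced e m.toUniformSpace.toTopologicalSpace := by
  have hc : Continuous e := continuous_iff_continuousAt.2 fun x =>
    tendsto_iff_dist_tendsto_zero.2 (h x)
  exact (hc.homeoOfEquivCompactToT2).isInducing.eq_induced

theorem topology_eq : (instTopologicalSpace : TopologicalSpace (UnitSphere n)) =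
    (geodesicMetric n).toPseudoMetricSpace.toUniformSpace.toTopologicalSpace := by
  refine Eq.trans (@eq_induced_of_continuous_equiv (UnitSphere n) (UnitSphere n)
    instTopologicalSpace inferInstance (geodesicMetric n) (Equiv.refl _) fun x => ?_)
    (@induced_id _ (geodesicMetric n).toUniformSpace.toTopologicalSpace)
  have hx : x.toVec ≠ 0 := norm_ne_zero_iff.1 (by rw [x.norm_toVec]; exact one_ne_zero)
  have h := (InnerProductGeometry.continuousAt_angle (x := (x.toVec, x.toVec)) hx hx).tendsto.comp
    ((continuous_toVec.prodMk continuous_const).tendsto x :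
      Tendsto (fun y : UnitSphere n => (y.toVec, x.toVec)) _ _)
  rw [InnerProductGeometry.angle_self hx] at h
  exact h

/-- The sphere with its geodesic metric, which induces the subspace topology. -/
instance : MetricSpace (UnitSphere n) := (geodesicMetric n).replaceTopology topology_eq

theorem dist_eq_angle (x y : UnitSphere n) :
    dist x y = InnerProductGeometry.angle x.toVec y.toVec := rfl

theorem dist_eq_arccos (x y : UnitSphere n) :
    dist x y = Real.arccos (inner ℝ x.toVec y.toVec) := by
  rw [dist_eq_angle, InnerProductGeometry.angle, x.norm_toVec, y.norm_toVec, mul_one, div_one]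

instance : Z2MetricSpace (UnitSphere n) where
  dist_neg_neg _ _ := InnerProductGeometry.angle_neg_neg _ _

end UnitSphere

/-! ### Real projective space with the quotient metric -/

/-- The relation `x ∼ ±x` on the sphere. -/
def antipodalSetoid (n : ℕ) : Setoid (UnitSphere n) where
  r x y := x = y ∨ x = -y
  iseqv :=
    { refl := fun _ => Or.inl rfl
      symm := by
        rintro x y (rfl | rfl)
        · exact Or.inl rfl
        · exact Or.inr (neg_neg y).symm
      trans := by
        rintro x y z (rfl | rfl) (rfl | rfl)
        · exact Or.inl rfl
        · exact Or.inr rfl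
        · exact Or.inr rfl
        · exact Or.inl (neg_neg z) }

/-- Real projective space `ℝPⁿ = Sⁿ / (x ∼ -x)`. -/
def RealProjectiveSpace (n : ℕ) : Type := Quotient (antipodalSetoid n)

namespace RealProjectiveSpace

variable {n : ℕ}

/-- The quotient map `Sⁿ → ℝPⁿ`. -/
def mk (x : UnitSphere n) : RealProjectiveSpace n := Quotient.mk (antipodalSetoid n) x

theorem dist_neg_left (x y : UnitSphere n) : dist (-x) y = dist x (-y) := by
  rw [← Z2MetricSpace.dist_neg_neg x (-y), neg_neg]

instance : Dist (RealProjectiveSpace n) where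
  dist := Quotient.lift₂ (fun x y : UnitSphere n => min (dist x y) (dist x (-y))) (by
    rintro a b c d (rfl | rfl) (rfl | rfl)
    · rfl
    · simp only [neg_neg, min_comm]
    · simp only [dist_neg_left, neg_neg, min_comm]
    · simp only [dist_neg_left, neg_neg])

theorem dist_mk (x y : UnitSphere n) : dist (mk x) (mk y) = min (dist x y) (dist x (-y)) := rfl

/-- The quotient metric `d({x,-x}, {y,-y}) = min (d(x,y), d(x,-y))`. -/
instance : MetricSpace (RealProjectiveSpace n) where
  dist_self := by
    intro x
    induction x using Quotient.inductionOn with | h x => ?_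
    change min (dist x x) (dist x (-x)) = 0
    rw [dist_self, min_eq_left dist_nonneg]
  dist_comm := by
    intro x y
    induction x, y using Quotient.inductionOn₂ with | h x y => ?_
    change min (dist x y) (dist x (-y)) = min (dist y x) (dist y (-x))
    rw [dist_comm x y, dist_comm x (-y), dist_neg_left]
  dist_triangle := by
    intro x y z
    induction x, y, z using Quotient.inductionOn₃ with | h x y z => ?_
    change min (dist x z) (dist x (-z)) ≤
      min (dist x y) (dist x (-y)) + min (dist y z) (dist y (-z))
    have h1 := dist_triangle x y z
    have h2 := dist_triangle x y (-z)
    have h3 := dist_triangle x (-y) z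
    have h4 := dist_triangle x (-y) (-z)
    rw [dist_neg_left] at h3
    rw [dist_neg_left, neg_neg] at h4
    rcases le_total (dist x y) (dist x (-y)) with a | a <;>
    rcases le_total (dist y z) (dist y (-z)) with b | b <;>
    rcases le_total (dist x z) (dist x (-z)) with c | c <;>
    simp only [a, b, c, min_eq_left, min_eq_right] <;> linarith
  eq_of_dist_eq_zero := by
    intro x y
    induction x, y using Quotient.inductionOn₂ with | h x y => ?_
    intro h
    replace h : min (dist x y) (dist x (-y)) = 0 := h
    apply Quotient.sound
    rcases min_choice (dist x y) (dist x (-y)) with e | e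
    · exact Or.inl (dist_eq_zero.1 (e.symm.trans h))
    · exact Or.inr (dist_eq_zero.1 (e.symm.trans h))

end RealProjectiveSpace

/-! ### The two quantities compared -/

/-- `cov_X(k)`: the infimum of the radii `ε > 0` for which `X` is covered by the `ε`-balls about
some finite set of at most `k` points. -/
def coveringRadius (X : Type*) [PseudoMetricSpace X] (k : ℕ) : ℝ :=
  sInf {ε : ℝ | 0 < ε ∧ ∃ A : Finset X, A.card ≤ k ∧ (⋃ a ∈ A, Metric.ball a ε) = Set.univ}

/-- `c_{n,k}`: the infimum of the scales `r ≥ 0` for which there is an odd (continuous) map from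
`S^k` to the Vietoris–Rips complex `VR(S^n; r)`. -/
def oddMapScale (n k : ℕ) : ℝ :=
  sInf {r : ℝ | 0 ≤ r ∧
    ∃ f : UnitSphere k → GeometricRealization (vietorisRips (UnitSphere n) r),
      Continuous f ∧ ∀ x, f (-x) = -f x}

end

/-! Suppose at most `k` balls of radius `ε` cover projective space and `r < π - 2ε`. Each centre,
lifted to the sphere, gives an odd function: a bump at the lift minus a bump at its antipode.
Extended affinely to the Vietoris–Rips complex, these functions form an odd map to a Euclidean space
of dimension at most `k`. It has no zero: a vertex in the support of a point lies within `ε` of some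
lift or its antipode, and no vertex within `r` of it can reach the opposite bump, so all terms of
that coordinate have one sign (`affineExtension_oddBump_pos`). Composing with an odd map from `S^k`
would contradict Borsuk–Ulam (`pi_sub_le_of_odd_map`). For the limit, covering radii tend to zero by
compactness, and at scale `π` a constant odd map exists (`odd_map_pi`).

Borsuk–Ulam is proved by a parity argument in the style of Ky Fan. If an odd map had no zero, label
each point of the cross-polytope boundary by a coordinate that is large there, with its sign. A fine
subdivision has no complementary labels in a simplex. The number modulo two of simplices whose
labels, sorted by index, alternate in sign is then computed twice: it is one by induction over the
spheres (`fanCount_crossCycle`), and zero because there are fewer indices than vertices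
(`fanCount_eq_zero`). -/

/-! ### Ordered chains modulo two -/

/-- Chains modulo two of ordered simplices, which are lists of vertices. -/
abbrev ListChain (V : Type*) := List V →₀ ZMod 2

noncomputable section

namespace ListChain

variable {V W : Type*}

/-- The chain of a single simplex. -/
def simplex (l : List V) : ListChain V := Finsupp.single l 1

theorem hom_ext {M : Type*} [AddCommMonoid M] [Module (ZMod 2) M] {f g : ListChain V →ₗ[ZMod 2] M}
    (h : ∀ l, f (simplex l) = g (simplex l)) : f = g :=
  Finsupp.lhom_ext' fun l => LinearMap.ext_ring (h l)

/-- Linear extension of a map defined on simplices. -/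
def extend {M : Type*} [AddCommMonoid M] [Module (ZMod 2) M] (f : List V → M) :
    ListChain V →ₗ[ZMod 2] M :=
  Finsupp.linearCombination (ZMod 2) f

@[simp]
theorem extend_simplex {M : Type*} [AddCommMonoid M] [Module (ZMod 2) M] (f : List V → M)
    (l : List V) : extend f (simplex l) = f l := by
  simp [extend, simplex]

theorem add_self (c : ListChain V) : c + c = 0 := by
  ext l
  exact CharTwo.add_self_eq_zero _

/-- The cone with apex `v`. -/
def cone (v : V) : ListChain V →ₗ[ZMod 2] ListChain V := extend fun l => simplex (v :: l)

@[simp]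
theorem cone_simplex (v : V) (l : List V) : cone v (simplex l) = simplex (v :: l) :=
  extend_simplex _ _

/-- The boundary of a simplex. The boundary of a vertex is the empty simplex. -/
def listBoundary : List V → ListChain V
  | [] => 0
  | v :: l => simplex l + cone v (listBoundary l)

/-- The augmented boundary operator. -/
def boundary : ListChain V →ₗ[ZMod 2] ListChain V := extend listBoundary

theorem boundary_nil : boundary (simplex ([] : List V)) = 0 := extend_simplex _ _

theorem boundary_cons (v : V) (l : List V) :
    boundary (simplex (v :: l)) = simplex l + cone v (boundary (simplex l)) := by
  simp [boundary, listBoundary]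

theorem boundary_cone (v : V) (c : ListChain V) :
    boundary (cone v c) = c + cone v (boundary c) :=
  LinearMap.congr_fun (f := boundary ∘ₗ cone v) (g := LinearMap.id + cone v ∘ₗ boundary)
    (hom_ext fun l => by simp [boundary_cons]) c

theorem boundary_boundary (c : ListChain V) : boundary (boundary c) = 0 := by
  refine LinearMap.congr_fun (f := boundary ∘ₗ boundary) (g := 0) (hom_ext fun l => ?_) c
  induction l with
  | nil => simp [boundary_nil]
  | cons v l ih =>
    simp only [LinearMap.comp_apply, LinearMap.zero_apply] at ih ⊢
    rw [boundary_cons, map_add, boundary_cone, ih, map_zero, add_zero, add_self]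

/-- The chain map induced by a map of vertices. -/
def map (f : V → W) : ListChain V →ₗ[ZMod 2] ListChain W := extend fun l => simplex (l.map f)

@[simp]
theorem map_simplex (f : V → W) (l : List V) : map f (simplex l) = simplex (l.map f) :=
  extend_simplex _ _

theorem map_cone (f : V → W) (v : V) (c : ListChain V) :
    map f (cone v c) = cone (f v) (map f c) :=
  LinearMap.congr_fun (f := map f ∘ₗ cone v) (g := cone (f v) ∘ₗ map f)
    (hom_ext fun l => by simp) c

theorem map_boundary (f : V → W) (c : ListChain V) : map f (boundary c) = boundary (map f c) := by
  refine LinearMap.congr_fun (f := map f ∘ₗ boundary) (g := boundary ∘ₗ map f)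
    (hom_ext fun l => ?_) c
  induction l with
  | nil => simp [boundary_nil]
  | cons v l ih =>
    simp only [LinearMap.comp_apply, map_simplex] at ih ⊢
    rw [boundary_cons, map_add, map_cone, ih, List.map_cons, boundary_cons, map_simplex]

/-- The chains all of whose simplices satisfy `P`. -/
def SupportedOn (P : List V → Prop) : Submodule (ZMod 2) (ListChain V) :=
  Submodule.span (ZMod 2) (simplex '' {l | P l})

theorem simplex_mem {P : List V → Prop} {l : List V} (h : P l) : simplex l ∈ SupportedOn P :=
  Submodule.subset_span ⟨l, h, rfl⟩

theorem map_mem_of_supportedOn {M : Type*} [AddCommMonoid M] [Module (ZMod 2) M]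
    {P : List V → Prop} (f : ListChain V →ₗ[ZMod 2] M) (S : Submodule (ZMod 2) M)
    (h : ∀ l, P l → f (simplex l) ∈ S) {c : ListChain V} (hc : c ∈ SupportedOn P) : f c ∈ S := by
  have : SupportedOn P ≤ S.comap f := by
    refine Submodule.span_le.2 ?_
    rintro _ ⟨l, hl, rfl⟩
    exact h l hl
  exact this hc

theorem SupportedOn.mono {P Q : List V → Prop} (h : ∀ l, P l → Q l) {c : ListChain V}
    (hc : c ∈ SupportedOn P) : c ∈ SupportedOn Q :=
  map_mem_of_supportedOn LinearMap.id _ (fun l hl => simplex_mem (h l hl)) hc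

theorem eq_of_supportedOn {M : Type*} [AddCommMonoid M] [Module (ZMod 2) M]
    {P : List V → Prop} (f g : ListChain V →ₗ[ZMod 2] M)
    (h : ∀ l, P l → f (simplex l) = g (simplex l)) {c : ListChain V} (hc : c ∈ SupportedOn P) :
    f c = g c := by
  have := map_mem_of_supportedOn LinearMap.id (LinearMap.eqLocus f g) h hc
  exact this

theorem boundary_mem (l : List V) :
    boundary (simplex l) ∈ SupportedOn fun l' => l'.length + 1 = l.length ∧ l' ⊆ l := by
  induction l with
  | nil => rw [boundary_nil]; exact zero_mem _
  | cons v l ih =>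
    rw [boundary_cons]
    refine add_mem (simplex_mem (by simp)) (map_mem_of_supportedOn _ _ (fun l' h => ?_) ih)
    rw [cone_simplex]
    refine simplex_mem ⟨by simp [h.1], List.cons_subset_cons v h.2⟩

/-! ### Counting alternating simplices -/

/-- The indicator of the lists of signs that alternate and begin with `s`. -/
def alternating : Bool → List Bool → ZMod 2
  | _, [] => 1
  | s, b :: l => if b = s then alternating (!s) l else 0

theorem alternating_not (s : Bool) (l : List Bool) :
    alternating s (l.map not) = alternating (!s) l := by
  induction l generalizing s with
  | nil => rfl
  | cons b l ih => cases b <;> cases s <;> simp [alternating, ih]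

/-- An alternating list has exactly one facet that alternates beginning with `s`, obtained by
dropping an end. A list with a single equal adjacent pair has its alternating facets in two equal
copies, which cancel; more defects leave none. -/
theorem alternating_boundary (s : Bool) (l : List Bool) :
    extend (alternating s) (boundary (simplex l)) = alternating s l + alternating (!s) l := by
  induction l generalizing s with
  | nil => simp [boundary_nil, alternating, CharTwo.add_self_eq_zero]
  | cons b l ih =>
    have hcone : ∀ c, extend (alternating s) (cone b c) =
        if b = s then extend (alternating (!s)) c else 0 := by
      intro c
      refine LinearMap.congr_fun (f := extend (alternating s) ∘ₗ cone b)
        (g := if b = s then extend (alternating (!s)) else 0) (hom_ext fun l => ?_) c |>.trans ?_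
      · split_ifs with h <;> simp [alternating, h]
      · split_ifs <;> rfl
    rw [boundary_cons, map_add, hcone, ih, extend_simplex]
    have h2 := CharTwo.add_self_eq_zero (R := ZMod 2) (alternating s l)
    cases b <;> cases s <;> simp [alternating] at h2 ⊢ <;> linear_combination h2

theorem isChain_of_alternating_ne_zero {s : Bool} {l : List Bool} (h : alternating s l ≠ 0) :
    l.IsChain (· ≠ ·) := by
  induction l generalizing s with
  | nil => simp
  | cons b l ih =>
    simp only [alternating] at h
    split_ifs at h with hb
    · cases l with
      | nil => simp
      | cons b' l =>
        refine List.isChain_cons_cons.2 ⟨?_, ih h⟩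
        simp only [alternating] at h
        split_ifs at h with hb'
        · rw [hb, hb']; cases s <;> simp
        · exact absurd rfl h
    · exact absurd rfl h

/-! ### Sorting simplices and Fan's parity count -/

section Sorting

variable {L : Type*} [LinearOrder L]

/-- The chain map that sorts the vertices of each simplex. -/
def sort : ListChain L →ₗ[ZMod 2] ListChain L := extend fun l => simplex (l.insertionSort (· ≤ ·))

/-- Insertion sort puts the head into the sorted tail, so sorting a cone factors through sorting its
base. -/
theorem sort_cone_congr (v : L) {c d : ListChain L} (h : sort c = sort d) :
    sort (cone v c) = sort (cone v d) := by
  have key : ∀ c, sort (cone v c) = extend (fun l => simplex (l.orderedInsert (· ≤ ·) v)) (sort c) :=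
    LinearMap.congr_fun (f := sort ∘ₗ cone v)
      (g := extend (fun l => simplex (l.orderedInsert (· ≤ ·) v)) ∘ₗ sort)
      (hom_ext fun l => by simp [sort])
  rw [key, key, h]

theorem insertionSort_eq_of_perm {l l' : List L} (h : l.Perm l') :
    l.insertionSort (· ≤ ·) = l'.insertionSort (· ≤ ·) :=
  (((l.perm_insertionSort _).trans h).trans (l'.perm_insertionSort _).symm).eq_of_pairwise'
    (l.pairwise_insertionSort _) (l'.pairwise_insertionSort _)

/-- Modulo two a permutation carries no sign, so permuting vertices only permutes the facets and
reorders each of them. -/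
theorem sort_boundary_eq_of_perm {l l' : List L} (h : l.Perm l') :
    sort (boundary (simplex l)) = sort (boundary (simplex l')) := by
  induction h with
  | nil => rfl
  | cons x h ih =>
    rw [boundary_cons, boundary_cons, map_add, map_add, sort_cone_congr x ih]
    simp [sort, insertionSort_eq_of_perm h]
  | swap x y l =>
    have hs : ∀ c, sort (cone x (cone y c)) = sort (cone y (cone x c)) :=
      LinearMap.congr_fun (f := sort ∘ₗ cone x ∘ₗ cone y) (g := sort ∘ₗ cone y ∘ₗ cone x)
        (hom_ext fun l => by
          simp only [LinearMap.comp_apply, cone_simplex, sort, extend_simplex]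
          rw [insertionSort_eq_of_perm (List.Perm.swap y x l)])
    simp only [boundary_cons, map_add, cone_simplex, hs]
    abel
  | trans _ _ h₁ h₂ => exact h₁.trans h₂

theorem sort_boundary (l : List L) (hl : l.Pairwise (· ≤ ·)) :
    sort (boundary (simplex l)) = boundary (simplex l) := by
  refine eq_of_supportedOn (P := fun l' => l'.Pairwise (· ≤ ·)) sort LinearMap.id (fun l' h => ?_) ?_
  · simp [sort, List.Pairwise.insertionSort_eq h]
  · suffices boundary (simplex l) ∈ SupportedOn fun l' => l'.Sublist l from
      SupportedOn.mono (fun _ h => hl.sublist h) this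
    clear hl
    induction l with
    | nil => rw [boundary_nil]; exact zero_mem _
    | cons v l ih =>
      rw [boundary_cons]
      refine add_mem (simplex_mem (List.sublist_cons_self v l))
        (map_mem_of_supportedOn _ _ (fun l' h => ?_) ih)
      rw [cone_simplex]
      exact simplex_mem (h.cons_cons v)

end Sorting

variable {ι : Type*} [LinearOrder ι]

/-- The number modulo two of simplices which, once sorted by the index of their labels, have
alternating signs beginning with `s`. -/
def fanCount (s : Bool) : ListChain (ι ×ₗ Bool) →ₗ[ZMod 2] ZMod 2 :=
  extend (fun l => alternating s (l.map fun a => (ofLex a).2)) ∘ₗ sort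

theorem fanCount_simplex (s : Bool) (l : List (ι ×ₗ Bool)) :
    fanCount s (simplex l) =
      alternating s ((l.insertionSort (· ≤ ·)).map fun a => (ofLex a).2) := by
  simp [fanCount, sort]

/-- Each simplex may be sorted before taking its boundary; only signs then matter, and
`alternating_boundary` applies. -/
theorem fanCount_boundary (s : Bool) (c : ListChain (ι ×ₗ Bool)) :
    fanCount s (boundary c) = fanCount s c + fanCount (!s) c := by
  suffices h : fanCount s ∘ₗ boundary = fanCount s + fanCount (ι := ι) (!s) by
    have := LinearMap.congr_fun h c
    rwa [LinearMap.comp_apply, LinearMap.add_apply] at this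
  refine hom_ext fun l => ?_
  have h1 : ∀ c : ListChain (ι ×ₗ Bool),
      extend (fun l => alternating s (l.map fun a => (ofLex a).2)) c =
        extend (alternating s) (map (fun a => (ofLex a).2) c) :=
    LinearMap.congr_fun
      (f := extend (fun l : List (ι ×ₗ Bool) => alternating s (l.map fun a => (ofLex a).2)))
      (g := extend (alternating s) ∘ₗ map (fun a => (ofLex a).2)) (hom_ext fun l => by simp)
  rw [LinearMap.comp_apply, LinearMap.add_apply, fanCount_simplex, fanCount_simplex, fanCount,
    LinearMap.comp_apply, sort_boundary_eq_of_perm (l.perm_insertionSort (· ≤ ·)).symm,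
    sort_boundary _ (l.pairwise_insertionSort _), h1, map_boundary, map_simplex,
    alternating_boundary]

/-- No index occurs in `l` with both signs. -/
def NoComplementary (l : List (ι ×ₗ Bool)) : Prop :=
  ∀ a ∈ l, ∀ b ∈ l, (ofLex a).1 = (ofLex b).1 → a = b

/-- Change the sign of a label. -/
def flipSign (a : ι ×ₗ Bool) : ι ×ₗ Bool := toLex ((ofLex a).1, !(ofLex a).2)

/-- Labels sharing an index are equal, so flipping all signs preserves the sorted order and just
exchanges the initial sign. -/
theorem fanCount_flipSign (s : Bool) {l : List (ι ×ₗ Bool)} (hl : NoComplementary l) :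
    fanCount s (simplex (l.map flipSign)) = fanCount (!s) (simplex l) := by
  have h : (l.map flipSign).insertionSort (· ≤ ·) =
      (l.insertionSort (· ≤ ·)).map flipSign := by
    refine List.Perm.eq_of_pairwise' (r := (· ≤ ·)) (List.pairwise_insertionSort _ _) ?_
      ((List.perm_insertionSort _ _).trans ((List.perm_insertionSort _ _).symm.map _))
    rw [List.pairwise_map]
    refine (List.pairwise_insertionSort (· ≤ ·) l).imp_of_mem fun {a b} ha hb hab => ?_
    rw [List.mem_insertionSort] at ha hb
    rcases Prod.Lex.le_iff.1 hab with h | h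
    · exact Prod.Lex.le_iff.2 (Or.inl h)
    · rw [hl a ha b hb h.1]
  rw [fanCount_simplex, fanCount_simplex, h, ← alternating_not, List.map_map, List.map_map]
  rfl

/-- Consecutive sorted labels of opposite sign must differ in index, so the indices strictly
increase and there are too few of them. -/
theorem fanCount_eq_zero [Fintype ι] (s : Bool) {l : List (ι ×ₗ Bool)} (hl : NoComplementary l)
    (hcard : Fintype.card ι < l.length) : fanCount s (simplex l) = 0 := by
  by_contra h
  rw [fanCount_simplex] at h
  have h1 := isChain_of_alternating_ne_zero h
  rw [List.isChain_map] at h1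
  have h2 := (List.pairwise_insertionSort (· ≤ ·) l).isChain
  have h3 : ((l.insertionSort (· ≤ ·)).map fun a => (ofLex a).1).IsChain (· < ·) := by
    rw [List.isChain_map]
    rw [List.isChain_iff_getElem] at h1 h2 ⊢
    intro i hi
    rcases Prod.Lex.le_iff.1 (h2 i hi) with h | h
    · exact h
    · refine absurd (congrArg (fun a => (ofLex a).2) (hl _ ?_ _ ?_ h.1)) (h1 i hi) <;>
      exact (List.mem_insertionSort _).1 (List.getElem_mem _)
  have h4 := (List.isChain_iff_pairwise.1 h3).imp (fun h => ne_of_lt h)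
  have h5 := List.Nodup.length_le_card h4
  rw [List.length_map, List.length_insertionSort] at h5
  omega

/-! ### Barycentric subdivision -/

section Subdivision

variable {E : Type*} [NormedAddCommGroup E] [NormedSpace ℝ E]

/-- The barycenter of the vertices of a simplex. -/
def barycenter (l : List E) : E := (l.length : ℝ)⁻¹ • l.sum

/-- Barycentric subdivision of simplices with `n` vertices. -/
def subdivision : ℕ → ListChain E →ₗ[ZMod 2] ListChain E
  | 0 => LinearMap.id
  | n + 1 => extend fun l => cone (barycenter l) (subdivision n (boundary (simplex l)))

theorem subdivision_succ_simplex (n : ℕ) (l : List E) : subdivision (n + 1) (simplex l) =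
    cone (barycenter l) (subdivision n (boundary (simplex l))) :=
  extend_simplex _ _

theorem boundary_subdivision (n : ℕ) (c : ListChain E) :
    boundary (subdivision (n + 1) c) = subdivision n (boundary c) := by
  induction n generalizing c with
  | zero =>
    suffices h : boundary ∘ₗ subdivision 1 = subdivision 0 ∘ₗ boundary (V := E) from
      LinearMap.congr_fun h c
    refine hom_ext fun l => ?_
    rw [LinearMap.comp_apply, LinearMap.comp_apply, subdivision_succ_simplex, boundary_cone]
    simp [subdivision, boundary_boundary]
  | succ n ih =>
    suffices h : boundary ∘ₗ subdivision (n + 2) = subdivision (n + 1) ∘ₗ boundary (V := E) from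
      LinearMap.congr_fun h c
    refine hom_ext fun l => ?_
    rw [LinearMap.comp_apply, LinearMap.comp_apply, subdivision_succ_simplex, boundary_cone, ih,
      boundary_boundary, map_zero, map_zero, add_zero]

theorem boundary_subdivision_iterate (n m : ℕ) (c : ListChain E) :
    boundary ((subdivision (n + 1))^[m] c) = (subdivision n)^[m] (boundary c) := by
  induction m generalizing c with
  | zero => rfl
  | succ m ih => rw [Function.iterate_succ_apply, Function.iterate_succ_apply, ih,
      boundary_subdivision]

theorem barycenter_map_neg (l : List E) : barycenter (l.map Neg.neg) = -barycenter l := by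
  have : (l.map Neg.neg).sum = -l.sum := by
    induction l with
    | nil => simp
    | cons v l ih => simp [ih, add_comm]
  rw [barycenter, barycenter, List.length_map, this, smul_neg]

theorem map_neg_subdivision (n : ℕ) (c : ListChain E) :
    map Neg.neg (subdivision n c) = subdivision n (map Neg.neg c) := by
  induction n generalizing c with
  | zero => rfl
  | succ n ih =>
    suffices h : map Neg.neg ∘ₗ subdivision (n + 1) =
        subdivision (n + 1) ∘ₗ map (Neg.neg : E → E) from LinearMap.congr_fun h c
    refine hom_ext fun l => ?_
    rw [LinearMap.comp_apply, LinearMap.comp_apply, subdivision_succ_simplex, map_cone, ih,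
      map_boundary, map_simplex, subdivision_succ_simplex, barycenter_map_neg]

theorem map_neg_subdivision_iterate (n m : ℕ) (c : ListChain E) :
    map Neg.neg ((subdivision n)^[m] c) = (subdivision n)^[m] (map Neg.neg c) := by
  induction m generalizing c with
  | zero => rfl
  | succ m ih => rw [Function.iterate_succ_apply, Function.iterate_succ_apply, ih,
      map_neg_subdivision]

theorem subdivision_iterate_add (n m : ℕ) (c d : ListChain E) :
    (subdivision n)^[m] (c + d) = (subdivision n)^[m] c + (subdivision n)^[m] d := by
  simp only [← Module.End.pow_apply, map_add]

theorem barycenter_mem_convexHull {l : List E} (hl : l ≠ []) :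
    barycenter l ∈ convexHull ℝ {x | x ∈ l} := by
  have h0 : (l.length : ℝ) ≠ 0 := by simpa using hl
  have : barycenter l = ∑ i : Fin l.length, (l.length : ℝ)⁻¹ • l[i] := by
    rw [← Finset.smul_sum, barycenter]
    congr 1
    exact (Fin.sum_univ_getElem l).symm
  rw [this]
  refine (convex_convexHull ℝ _).sum_mem (fun _ _ => by positivity) ?_
    fun i _ => subset_convexHull ℝ _ (List.getElem_mem _)
  simp [h0]

/-- In the average of the differences from `v`, the term of `v` itself vanishes, which gains the
factor below one. -/
theorem dist_barycenter_le {l : List E} {d : ℝ} (hd : ∀ x ∈ l, ∀ y ∈ l, dist x y ≤ d) {v : E}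
    (hv : v ∈ l) : dist (barycenter l) v ≤ (l.length : ℝ)⁻¹ * ((l.length - 1) * d) := by
  classical
  have hpos : (0 : ℝ) < l.length := by exact_mod_cast List.length_pos_of_mem hv
  have hp := List.perm_cons_erase hv
  have hsum : ∀ l' : List E, (∀ x ∈ l', dist x v ≤ d) →
      ‖l'.sum - (l'.length : ℝ) • v‖ ≤ l'.length * d := by
    intro l' h
    induction l' with
    | nil => simp
    | cons w l' ih =>
      have h1 := ih fun x hx => h x (List.mem_cons_of_mem _ hx)
      have h2 := h w List.mem_cons_self
      rw [dist_eq_norm] at h2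
      have h3 : (w :: l').sum - ((w :: l').length : ℝ) • v =
          (w - v) + (l'.sum - (l'.length : ℝ) • v) := by
        simp only [List.sum_cons, List.length_cons, Nat.cast_add, Nat.cast_one, add_smul, one_smul]
        abel
      rw [h3]
      refine (norm_add_le _ _).trans ?_
      simp only [List.length_cons, Nat.cast_add, Nat.cast_one]
      linarith
  have h1 := hsum (l.erase v) fun x hx => hd x (List.mem_of_mem_erase hx) v hv
  have hlen : (l.length : ℝ) = (l.erase v).length + 1 := by
    rw [hp.length_eq]; simp
  have h2 : barycenter l - v =
      (l.length : ℝ)⁻¹ • ((l.erase v).sum - ((l.erase v).length : ℝ) • v) := by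
    have h3 : (l.erase v).sum - ((l.erase v).length : ℝ) • v = l.sum - (l.length : ℝ) • v := by
      rw [hp.sum_eq, hlen, add_smul, one_smul, List.sum_cons]
      abel
    rw [h3, smul_sub, smul_smul, inv_mul_cancel₀ hpos.ne', one_smul, barycenter]
  rw [dist_eq_norm, h2, norm_smul, norm_inv, Real.norm_of_nonneg hpos.le]
  refine mul_le_mul_of_nonneg_left (h1.trans_eq ?_) (by positivity)
  rw [hlen]; ring

/-- The bound `N` keeps the contraction factor the same for all faces met in the induction on `n`.
-/
theorem subdivision_mem {N n : ℕ} (hn : n ≤ N) {l : List E} (hl : l.length = n) {d : ℝ}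
    (hd : ∀ x ∈ l, ∀ y ∈ l, dist x y ≤ d) :
    subdivision n (simplex l) ∈ SupportedOn fun l' => l'.length = n ∧
      (∀ x ∈ l', x ∈ convexHull ℝ {x | x ∈ l}) ∧
      ∀ x ∈ l', ∀ y ∈ l', dist x y ≤ (1 - (N : ℝ)⁻¹) * d := by
  induction n generalizing l with
  | zero =>
    rw [List.length_eq_zero_iff] at hl
    subst hl
    exact simplex_mem (by simp)
  | succ n ih =>
    have hN : (0 : ℝ) < N := by exact_mod_cast (Nat.succ_pos n).trans_le hn
    have hne : l ≠ [] := by rintro rfl; simp at hl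
    have hd0 : 0 ≤ d := by
      obtain ⟨v, hv⟩ := List.exists_mem_of_ne_nil l hne
      simpa using hd v hv v hv
    have hN1 : (1 : ℝ) ≤ N := by exact_mod_cast (Nat.succ_pos n).trans_le hn
    have hr : ∀ v ∈ l, dist v (barycenter l) ≤ (1 - (N : ℝ)⁻¹) * d := by
      intro v hv
      rw [dist_comm]
      refine (dist_barycenter_le hd hv).trans ?_
      rw [← mul_assoc]
      refine mul_le_mul_of_nonneg_right ?_ hd0
      have hlpos : (0 : ℝ) < l.length := by rw [hl]; positivity
      rw [mul_sub, inv_mul_cancel₀ hlpos.ne', mul_one]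
      have : (l.length : ℝ) ≤ N := by rw [hl]; exact_mod_cast hn
      have := inv_anti₀ hlpos this
      linarith
    have hr' : ∀ x ∈ convexHull ℝ {x | x ∈ l}, dist x (barycenter l) ≤ (1 - (N : ℝ)⁻¹) * d :=
      fun x hx => convexHull_min (fun v hv => Metric.mem_closedBall.2 (hr v hv))
        (convex_closedBall _ _) hx
    rw [subdivision_succ_simplex]
    refine map_mem_of_supportedOn (cone (barycenter l) ∘ₗ subdivision n) _ (fun l' h => ?_)
      (boundary_mem l)
    rw [LinearMap.comp_apply]
    refine map_mem_of_supportedOn (cone (barycenter l)) _ (fun l'' h'' => ?_)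
      (ih (by omega) (l := l') (by omega) fun x hx y hy => hd x (h.2 hx) y (h.2 hy))
    rw [cone_simplex]
    have hsub : ∀ x ∈ l'', x ∈ convexHull ℝ {x | x ∈ l} := fun x hx =>
      convexHull_mono (fun y hy => h.2 hy) (h''.2.1 x hx)
    refine simplex_mem ⟨by simp [h''.1], ?_, ?_⟩
    · rintro x hx
      rcases List.mem_cons.1 hx with rfl | hx
      · exact barycenter_mem_convexHull hne
      · exact hsub x hx
    · intro x hx y hy
      have h0 : 0 ≤ (1 - (N : ℝ)⁻¹) * d :=
        mul_nonneg (sub_nonneg.2 (inv_le_one_of_one_le₀ hN1)) hd0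
      rcases List.mem_cons.1 hx with rfl | hx <;> rcases List.mem_cons.1 hy with rfl | hy
      · simpa using h0
      · rw [dist_comm]; exact hr' _ (hsub y hy)
      · exact hr' _ (hsub x hx)
      · exact h''.2.2 x hx y hy

/-- Lists of `n` points at mutual distance at most `d`, with convex hull contained in `K`. -/
def SmallIn (K : Set E) (n : ℕ) (d : ℝ) (l : List E) : Prop :=
  l.length = n ∧ convexHull ℝ {x | x ∈ l} ⊆ K ∧ ∀ x ∈ l, ∀ y ∈ l, dist x y ≤ d

theorem subdivision_iterate_mem {K : Set E} {N n : ℕ} (hn : n ≤ N) {d : ℝ} {c : ListChain E}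
    (hc : c ∈ SupportedOn (SmallIn K n d)) (m : ℕ) :
    (subdivision n)^[m] c ∈ SupportedOn (SmallIn K n ((1 - (N : ℝ)⁻¹) ^ m * d)) := by
  induction m with
  | zero => simpa using hc
  | succ m ih =>
    rw [Function.iterate_succ_apply']
    refine map_mem_of_supportedOn _ _ (fun l hl => ?_) ih
    refine SupportedOn.mono (fun l' hl' => ⟨hl'.1, ?_, ?_⟩) (subdivision_mem hn hl.1 hl.2.2)
    · exact (convexHull_min (fun x hx => hl'.2.1 x hx) (convex_convexHull ℝ _)).trans hl.2.1
    · rw [pow_succ', mul_assoc]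
      exact hl'.2.2

end Subdivision

/-! ### The boundary of the cross-polytope -/

section CrossPolytope

variable {E : Type*} [NormedAddCommGroup E]

/-- The fundamental cycle of the boundary of the cross-polytope with vertices `± e 0, …,
± e (i - 1)`. -/
def crossCycle (e : ℕ → E) : ℕ → ListChain E
  | 0 => simplex []
  | i + 1 => cone (e i) (crossCycle e i) + cone (-e i) (crossCycle e i)

theorem boundary_crossCycle (e : ℕ → E) (i : ℕ) : boundary (crossCycle e i) = 0 := by
  induction i with
  | zero => exact boundary_nil
  | succ i ih => simp [crossCycle, boundary_cone, ih, add_self]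

theorem map_neg_crossCycle (e : ℕ → E) (i : ℕ) :
    map Neg.neg (crossCycle e i) = crossCycle e i := by
  induction i with
  | zero => simp [crossCycle]
  | succ i ih => simp [crossCycle, map_cone, ih, add_comm]

variable {ι : Type*} [LinearOrder ι]

/-- The lists without complementary labels on which the labelling is odd. -/
def GoodFor (lab : E → ι ×ₗ Bool) (l : List E) : Prop :=
  NoComplementary (l.map lab) ∧ ∀ x ∈ l, lab (-x) = flipSign (lab x)

theorem fanCount_map_neg (s : Bool) {lab : E → ι ×ₗ Bool} {c : ListChain E}
    (hc : c ∈ SupportedOn (GoodFor lab)) :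
    fanCount s (map lab (map Neg.neg c)) = fanCount (!s) (map lab c) := by
  refine eq_of_supportedOn (fanCount s ∘ₗ map lab ∘ₗ map Neg.neg) (fanCount (!s) ∘ₗ map lab)
    (fun l hl => ?_) hc
  simp only [LinearMap.comp_apply, map_simplex]
  rw [← fanCount_flipSign s hl.1, List.map_map, List.map_map]
  congr 2
  exact List.map_congr_left hl.2

variable [NormedSpace ℝ E]

/-- The lists of `i` vertices contained in a face of the cross-polytope with vertices `± e 0, …,
± e (i - 1)`. -/
def CrossFace (e : ℕ → E) (i : ℕ) (l : List E) : Prop :=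
  l.length = i ∧ ∃ s : ℕ → ℝ, (∀ j, s j = 1 ∨ s j = -1) ∧ ∀ x ∈ l, ∃ j < i, x = s j • e j

theorem cone_mem_crossFace (e : ℕ → E) {i : ℕ} {c : ListChain E}
    (hc : c ∈ SupportedOn (CrossFace e i)) {a : ℝ} (ha : a = 1 ∨ a = -1) :
    cone (a • e i) c ∈ SupportedOn (CrossFace e (i + 1)) := by
  refine map_mem_of_supportedOn _ _ (fun l hl => ?_) hc
  obtain ⟨hl, s, hs, hx⟩ := hl
  rw [cone_simplex]
  refine simplex_mem ⟨by simp [hl], Function.update s i a, fun j => ?_, fun x h => ?_⟩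
  · rcases eq_or_ne j i with rfl | h
    · simpa using ha
    · simpa [h] using hs j
  · rcases List.mem_cons.1 h with rfl | h
    · exact ⟨i, by simp, by simp⟩
    · obtain ⟨j, hj, rfl⟩ := hx x h
      exact ⟨j, by omega, by rw [Function.update_of_ne hj.ne]⟩

theorem crossCycle_mem (e : ℕ → E) (i : ℕ) : crossCycle e i ∈ SupportedOn (CrossFace e i) := by
  induction i with
  | zero => exact simplex_mem ⟨rfl, fun _ => 1, by simp, by simp⟩
  | succ i ih =>
    have h1 := cone_mem_crossFace e ih (a := 1) (by simp)
    have h2 := cone_mem_crossFace e ih (a := -1) (by simp)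
    rw [one_smul] at h1
    rw [neg_one_smul] at h2
    exact add_mem h1 h2

/-- The sphere is a hemisphere plus its antipode. By oddness the antipode contributes the
hemisphere's count with the other initial sign, and `fanCount_boundary` turns the sum into the count
on the equator. The induction ends at the empty simplex, which counts once. -/
theorem fanCount_crossCycle {k : ℕ} (e : ℕ → E) (lab : E → ι ×ₗ Bool) (m : ℕ)
    (h : ∀ i ≤ k, (subdivision (i + 1))^[m] (cone (e i) (crossCycle e i)) ∈
      SupportedOn (GoodFor lab)) {i : ℕ} (hi : i ≤ k + 1) :
    fanCount true (map lab ((subdivision i)^[m] (crossCycle e i))) = 1 := by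
  induction i with
  | zero =>
    have : (subdivision 0)^[m] (crossCycle e 0) = simplex [] := by
      clear h
      induction m with
      | zero => rfl
      | succ m ih => rw [Function.iterate_succ_apply', ih]; rfl
    rw [this, map_simplex, fanCount_simplex]
    rfl
  | succ i ih =>
    have hD : boundary (cone (e i) (crossCycle e i)) = crossCycle e i := by
      rw [boundary_cone, boundary_crossCycle, map_zero, add_zero]
    have hneg : cone (-e i) (crossCycle e i) = map Neg.neg (cone (e i) (crossCycle e i)) := by
      rw [map_cone, map_neg_crossCycle]
    rw [crossCycle, hneg, subdivision_iterate_add, ← map_neg_subdivision_iterate, map_add, map_add,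
      fanCount_map_neg true (h i (by omega)), ← fanCount_boundary, ← map_boundary,
      boundary_subdivision_iterate, hD]
    exact ih (by omega)

end CrossPolytope

end ListChain

/-! ### The Borsuk–Ulam theorem -/

open ListChain in
/-- The **Borsuk–Ulam theorem** on the boundary of the cross-polytope. -/
theorem exists_zero_of_odd_pi {k : ℕ} {ι : Type*} [LinearOrder ι] [Fintype ι]
    (hι : Fintype.card ι ≤ k) (F : (Fin (k + 1) → ℝ) → ι → ℝ) (hF : ContinuousOn F {0}ᶜ)
    (hodd : ∀ x, x ≠ 0 → F (-x) = -F x) : ∃ x, x ≠ 0 ∧ F x = 0 := by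
  classical
  by_contra! hne
  set K : Set (Fin (k + 1) → ℝ) := {x | ∑ j, |x j| = 1} with hK
  have hK0 : K ⊆ {0}ᶜ := by
    rintro x hx rfl
    simp [hK] at hx
  have hKnorm : ∀ x ∈ K, ‖x‖ ≤ 1 := by
    intro x hx
    refine (pi_norm_le_iff_of_nonneg zero_le_one).2 fun j => ?_
    rw [← show ∑ j, |x j| = 1 from hx, Real.norm_eq_abs]
    exact Finset.single_le_sum (f := fun j => |x j|) (fun _ _ => abs_nonneg _) (Finset.mem_univ j)
  have hKc : IsCompact K := by
    refine Metric.isCompact_of_isClosed_isBounded ?_ ?_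
    · exact isClosed_eq (by fun_prop) continuous_const
    · exact Metric.isBounded_closedBall.subset
        fun x hx => mem_closedBall_zero_iff.2 (hKnorm x hx)
  have hFK := hF.mono hK0
  have hKne : K.Nonempty := ⟨Pi.single 0 1, by
    simp only [hK, Set.mem_ofPred_eq]
    rw [Finset.sum_eq_single 0] <;> simp +contextual⟩
  obtain ⟨x₀, hx₀, hmin⟩ := hKc.exists_isMinOn hKne hFK.norm
  set η := ‖F x₀‖
  have hη : 0 < η := norm_pos_iff.2 (hne x₀ (hK0 hx₀))
  have : Nonempty ι := by
    by_contra h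
    rw [not_nonempty_iff] at h
    exact hne x₀ (hK0 hx₀) (Subsingleton.elim _ _)
  -- The choice depends only on the predicate, which is the same at `x` and `-x`; hence the index is
  -- even.
  let idx : (Fin (k + 1) → ℝ) → ι := fun x => Classical.epsilon fun i => η ≤ |F x i|
  have hidx : ∀ x ∈ K, η ≤ |F x (idx x)| := by
    intro x hx
    refine Classical.epsilon_spec (p := fun i => η ≤ |F x i|) ?_
    by_contra! h
    exact absurd ((pi_norm_lt_iff hη).2 h) (not_lt.2 (hmin hx))
  let lab : (Fin (k + 1) → ℝ) → ι ×ₗ Bool := fun x => toLex (idx x, decide (0 < F x (idx x)))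
  have hlab : ∀ x ∈ K, lab (-x) = flipSign (lab x) := by
    intro x hx
    have ho := hodd x (hK0 hx)
    have h1 : idx (-x) = idx x := by simp only [idx, ho, Pi.neg_apply, abs_neg]
    have h2 := hη.trans_le (hidx x hx)
    rw [abs_pos] at h2
    simp only [lab, flipSign, h1, ofLex_toLex, ho, Pi.neg_apply]
    congr 2
    rcases h2.lt_or_gt with h | h
    · simp [h, h.le]
    · simp [h, h.le]
  obtain ⟨δ, hδ, hunif⟩ := Metric.uniformContinuousOn_iff.1
    (hKc.uniformContinuousOn_of_continuous hFK) η hη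
  -- Complementary labels would make one coordinate of `F` jump by at least `2 * η` over a distance
  -- below `δ`.
  have hgood : ∀ n d, d < δ → ∀ l, SmallIn K n d l → GoodFor lab l := by
    intro n d hd l hl
    have hlK : ∀ x ∈ l, x ∈ K := fun x hx => hl.2.1 (subset_convexHull ℝ _ hx)
    refine ⟨?_, fun x hx => hlab x (hlK x hx)⟩
    intro a ha b hb hab
    obtain ⟨x, hx, rfl⟩ := List.mem_map.1 ha
    obtain ⟨y, hy, rfl⟩ := List.mem_map.1 hb
    replace hab : idx x = idx y := hab
    have h1 := hidx x (hlK x hx)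
    have h2 := hidx y (hlK y hy)
    have h3 := (dist_le_pi_dist (F x) (F y) (idx y)).trans_lt
      (hunif x (hlK x hx) y (hlK y hy) ((hl.2.2 x hx y hy).trans_lt hd))
    rw [Real.dist_eq, abs_lt] at h3
    simp only [lab, hab]
    rw [hab] at h1
    congr 2
    rw [decide_eq_decide]
    rw [le_abs] at h1 h2
    constructor <;> intro h <;> rcases h1 with h1 | h1 <;> rcases h2 with h2 | h2 <;> linarith
  let e : ℕ → Fin (k + 1) → ℝ := fun i => if h : i < k + 1 then Pi.single ⟨i, h⟩ 1 else 0
  have hface : ∀ i ≤ k + 1, ∀ l, CrossFace e i l → SmallIn K i 2 l := by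
    rintro i hi l ⟨hl, s, hs, hx⟩
    have hsK : convexHull ℝ {x | x ∈ l} ⊆ K := by
      -- In the closed orthant with signs `s` the ℓ¹ norm is linear, so this convex set lies in `K`.
      have hC : Convex ℝ {x : Fin (k + 1) → ℝ |
          ∑ j : Fin (k + 1), s j * x j = 1 ∧ ∀ j : Fin (k + 1), 0 ≤ s j * x j} := by
        rintro x ⟨hx1, hx2⟩ y ⟨hy1, hy2⟩ a b ha hb hab
        refine ⟨?_, fun j => ?_⟩
        · have : ∑ j : Fin (k + 1), s j * (a • x + b • y) j =
              a * ∑ j : Fin (k + 1), s j * x j + b * ∑ j : Fin (k + 1), s j * y j := by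
            rw [Finset.mul_sum, Finset.mul_sum, ← Finset.sum_add_distrib]
            exact Finset.sum_congr rfl fun j _ => by
              simp only [Pi.add_apply, Pi.smul_apply, smul_eq_mul]; ring
          rw [this, hx1, hy1, mul_one, mul_one, hab]
        · have := add_nonneg (mul_nonneg ha (hx2 j)) (mul_nonneg hb (hy2 j))
          simp only [Pi.add_apply, Pi.smul_apply, smul_eq_mul]
          linarith
      refine (convexHull_min ?_ hC).trans ?_
      · intro x hxl
        obtain ⟨j, hj, rfl⟩ := hx x hxl
        have hj' : j < k + 1 := by omega
        have hsj : s j * s j = 1 := by rcases hs j with h | h <;> rw [h] <;> norm_num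
        have hval : ∀ j' : Fin (k + 1), s j' * (s j • e j) j' = if j' = ⟨j, hj'⟩ then 1 else 0 := by
          intro j'
          simp only [e, hj', dif_pos, Pi.smul_apply, smul_eq_mul, Pi.single_apply]
          split_ifs with h
          · rw [h, mul_one, hsj]
          · simp
        refine ⟨?_, fun j' => ?_⟩
        · exact (Finset.sum_congr rfl fun j' _ => hval j').trans (by simp)
        · rw [hval]; split_ifs <;> norm_num
      · rintro x ⟨hx1, hx2⟩
        refine Eq.trans (Finset.sum_congr rfl fun j _ => ?_) hx1
        rw [← abs_of_nonneg (hx2 j), abs_mul]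
        rcases hs j with h | h <;> simp [h]
    refine ⟨hl, hsK, fun x hxl y hyl => ?_⟩
    have h1 := hKnorm x (hsK (subset_convexHull ℝ _ hxl))
    have h2 := hKnorm y (hsK (subset_convexHull ℝ _ hyl))
    rw [dist_eq_norm]
    linarith [norm_sub_le x y]
  have hθ : 1 - ((k + 1 : ℕ) : ℝ)⁻¹ < 1 := sub_lt_self _ (by positivity)
  obtain ⟨m, hm⟩ := exists_pow_lt_of_lt_one (half_pos hδ) hθ
  have hd : (1 - ((k + 1 : ℕ) : ℝ)⁻¹) ^ m * 2 < δ := by linarith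
  have hcone : ∀ i ≤ k, (subdivision (i + 1))^[m] (cone (e i) (crossCycle e i)) ∈
      SupportedOn (GoodFor lab) := by
    intro i hi
    have h1 := cone_mem_crossFace e (crossCycle_mem e i) (a := 1) (by simp)
    rw [one_smul] at h1
    exact SupportedOn.mono (hgood _ _ hd)
      (subdivision_iterate_mem (by omega) (SupportedOn.mono (hface _ (by omega)) h1) m)
  have h1 := fanCount_crossCycle e lab m hcone le_rfl
  have h2 := subdivision_iterate_mem (N := k + 1) le_rfl
    (SupportedOn.mono (hface _ le_rfl) (crossCycle_mem e (k + 1))) m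
  have h3 := eq_of_supportedOn (fanCount true ∘ₗ map lab) 0 (fun l hl => by
    rw [LinearMap.comp_apply, map_simplex, LinearMap.zero_apply]
    refine fanCount_eq_zero true (hgood _ _ hd l hl).1 ?_
    rw [List.length_map, hl.1]
    omega) h2
  rw [LinearMap.comp_apply, h1] at h3
  exact one_ne_zero h3

/-- The **Borsuk–Ulam theorem**. -/
theorem UnitSphere.exists_eq_zero_of_odd {k : ℕ} {ι : Type*} [LinearOrder ι] [Fintype ι]
    (hι : Fintype.card ι ≤ k) (g : UnitSphere k → ι → ℝ) (hg : Continuous g)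
    (hodd : ∀ x, g (-x) = -g x) : ∃ x, g x = 0 := by
  let v : (Fin (k + 1) → ℝ) → EuclideanSpace ℝ (Fin (k + 1)) := WithLp.toLp 2
  have hv : Continuous v := PiLp.continuous_toLp 2 _
  have hv0 : ∀ {x}, x ≠ 0 → v x ≠ 0 := fun {x} hx h => hx (by simpa [v] using h)
  have hmem : ∀ {x : Fin (k + 1) → ℝ}, x ≠ 0 →
      ‖v x‖⁻¹ • v x ∈ Metric.sphere (0 : EuclideanSpace ℝ (Fin (k + 1))) 1 :=
    fun {x} hx => by
      rw [mem_sphere_zero_iff_norm, norm_smul, norm_inv, norm_norm,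
        inv_mul_cancel₀ (norm_ne_zero_iff.2 (hv0 hx))]
  -- Radial projection; the value assigned below at the origin plays no role.
  let p : ∀ x : Fin (k + 1) → ℝ, x ≠ 0 → UnitSphere k := fun x hx => ⟨‖v x‖⁻¹ • v x, hmem hx⟩
  classical
  suffices h : ∃ x, x ≠ 0 ∧ (if hx : x ≠ 0 then g (p x hx) else 0) = 0 by
    obtain ⟨x, hx, h⟩ := h
    rw [dif_pos hx] at h
    exact ⟨_, h⟩
  refine exists_zero_of_odd_pi hι (fun x => if hx : x ≠ 0 then g (p x hx) else 0) ?_ ?_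
  · rw [continuousOn_iff_continuous_domRestrict]
    have : Set.domRestrict {0}ᶜ (fun x => if hx : x ≠ 0 then g (p x hx) else 0) =
        fun x : ({0}ᶜ : Set (Fin (k + 1) → ℝ)) => g (p x.1 x.2) := by
      funext x
      exact dif_pos x.2
    rw [this]
    refine hg.comp (Continuous.subtype_mk ?_ _)
    have hc := hv.comp (continuous_subtype_val (p := fun x : Fin (k + 1) → ℝ => x ∈ ({0}ᶜ : Set _)))
    exact (hc.norm.inv₀ fun x => norm_ne_zero_iff.2 (hv0 x.2)).smul hc
  · intro x hx
    rw [dif_pos hx, dif_pos (neg_ne_zero.2 hx), ← hodd]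
    congr 1
    refine Subtype.ext ?_
    change ‖v (-x)‖⁻¹ • v (-x) = -(‖v x‖⁻¹ • v x)
    have : v (-x) = -v x := rfl
    rw [this, norm_neg, smul_neg]

/-! ### Maps out of a geometric realization -/

namespace GeometricRealization

variable {V : Type*} {K : PreAbstractSimplicialComplex V}

/-- The linear extension of a real function on the vertices. -/
def affineExtension (h : V → ℝ) (p : GeometricRealization K) : ℝ := p.1.sum fun v a => a * h v

/-- In the weak topology it suffices to check closed simplices, where this is a finite linear
combination of coordinates. No continuity of `h` is needed. -/
theorem continuous_affineExtension (h : V → ℝ) :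
    Continuous (affineExtension h : GeometricRealization K → ℝ) := by
  refine continuous_iSup_dom.2 fun σ => continuous_iSup_dom.2 fun _ => continuous_coinduced_dom.2 ?_
  have : (affineExtension h ∘ fun p : ClosedSimplex K σ => p.1) =
      fun p => ∑ v ∈ σ, p.1.coord v * h v := by
    funext p
    exact Finsupp.sum_of_support_subset _ p.2 (fun v a => a * h v) (by simp)
  rw [this]
  have hc : Continuous fun (p : ClosedSimplex K σ) (v : V) => p.1.coord v := continuous_induced_dom
  exact continuous_finsetSum _ fun v _ => ((continuous_apply v).comp hc).mul_const _

theorem affineExtension_neg {X : Type*} [PseudoMetricSpace X] [InvolutiveNeg X] [Z2MetricSpace X]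
    {r : ℝ} {h : X → ℝ} (hh : ∀ x, h (-x) = -h x) (p : GeometricRealization (vietorisRips X r)) :
    affineExtension h (-p) = -affineExtension h p := by
  change (p.1.mapDomain fun x => -x).sum (fun v a => a * h v) = _
  rw [Finsupp.sum_mapDomain_index (by simp) (by intros; ring), affineExtension, Finsupp.sum,
    Finsupp.sum, ← Finset.sum_neg_distrib]
  exact Finset.sum_congr rfl fun v _ => by rw [hh, mul_neg]

theorem affineExtension_pos {h : V → ℝ} (p : GeometricRealization K)
    (h0 : ∀ v ∈ p.1.support, 0 ≤ h v) {w : V} (hw : w ∈ p.1.support) (hpos : 0 < h w) :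
    0 < affineExtension h p :=
  Finset.sum_pos' (fun v hv => mul_nonneg (p.2.1 v) (h0 v hv))
    ⟨w, hw, mul_pos ((p.2.1 w).lt_of_ne (Finsupp.mem_support_iff.1 hw).symm) hpos⟩

theorem dist_le_of_mem_support {X : Type*} [PseudoMetricSpace X] {r : ℝ}
    (p : GeometricRealization (vietorisRips X r)) {x y : X} (hx : x ∈ p.1.support)
    (hy : y ∈ p.1.support) : dist x y ≤ r :=
  (Metric.dist_le_diam_of_mem p.1.support.finite_toSet.isBounded hx hy).trans p.2.2.2.2

end GeometricRealization

/-! ### The lower bound -/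

namespace UnitSphere

variable {n : ℕ}

theorem dist_neg_self (x : UnitSphere n) : dist x (-x) = Real.pi := by
  rw [dist_eq_angle, toVec_neg]
  exact InnerProductGeometry.angle_self_neg_of_nonzero
    (norm_ne_zero_iff.1 (by rw [x.norm_toVec]; exact one_ne_zero))

theorem dist_le_pi (x y : UnitSphere n) : dist x y ≤ Real.pi :=
  InnerProductGeometry.angle_le_pi _ _

/-- The difference of the bump functions of radius `ε` about `a` and about `-a`. -/
def oddBump (a : UnitSphere n) (ε : ℝ) (x : UnitSphere n) : ℝ :=
  max 0 (ε - dist x a) - max 0 (ε - dist (-x) a)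

theorem oddBump_neg (a : UnitSphere n) (ε : ℝ) (x : UnitSphere n) :
    oddBump a ε (-x) = -oddBump a ε x := by
  simp [oddBump]

-- If some `z` in the support had `-z` within `ε` of `a`, the path `z`, `y`, `a`, `-z` would give `π
-- ≤ r + 2 * ε`. So the negative bump vanishes on the whole support.
open GeometricRealization in
theorem affineExtension_oddBump_pos {r ε : ℝ} (hr : r < Real.pi - 2 * ε)
    (p : GeometricRealization (vietorisRips (UnitSphere n) r)) {a y : UnitSphere n}
    (hy : y ∈ p.1.support) (hya : dist y a < ε) : 0 < affineExtension (oddBump a ε) p := by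
  have hfar : ∀ z ∈ p.1.support, max 0 (ε - dist (-z) a) = 0 := by
    intro z hz
    refine max_eq_left ?_
    have h1 := dist_le_of_mem_support p hz hy
    have h2 := dist_triangle4 z y a (-z)
    rw [dist_neg_self, dist_comm a] at h2
    linarith
  refine affineExtension_pos p (fun z hz => ?_) hy ?_
  · rw [oddBump, hfar z hz, sub_zero]
    exact le_max_left _ _
  · rw [oddBump, hfar y hy, sub_zero]
    exact lt_max_of_lt_right (sub_pos.2 hya)

end UnitSphere

open GeometricRealization UnitSphere in
theorem pi_sub_le_of_odd_map {n k : ℕ} {r ε : ℝ} {A : Finset (RealProjectiveSpace n)}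
    (hA : A.card ≤ k) (hcov : (⋃ a ∈ A, Metric.ball a ε) = Set.univ)
    {f : UnitSphere k → GeometricRealization (vietorisRips (UnitSphere n) r)} (hf : Continuous f)
    (hodd : ∀ x, f (-x) = -f x) : Real.pi - 2 * ε ≤ r := by
  by_contra! hr
  let rep : Fin A.card → UnitSphere n := fun i => Quotient.out (A.equivFin.symm i).1
  obtain ⟨x, hx⟩ := exists_eq_zero_of_odd (ι := Fin A.card) (by simpa using hA)
    (fun x i => affineExtension (oddBump (rep i) ε) (f x))
    (continuous_pi fun i => (continuous_affineExtension _).comp hf)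
    (fun x => funext fun i => by
      rw [hodd]; exact affineExtension_neg (oddBump_neg _ _) _)
  obtain ⟨y, hy⟩ := (f x).2.2.2.1
  have hmem : RealProjectiveSpace.mk y ∈ ⋃ a ∈ A, Metric.ball a ε := hcov ▸ Set.mem_univ _
  simp only [Set.mem_iUnion, Metric.mem_ball, exists_prop] at hmem
  obtain ⟨a, ha, hya⟩ := hmem
  obtain ⟨i, hi⟩ : ∃ i, RealProjectiveSpace.mk (rep i) = a :=
    ⟨A.equivFin ⟨a, ha⟩, by
      simp only [rep, Equiv.symm_apply_apply]
      exact Quotient.out_eq a⟩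
  rw [← hi, RealProjectiveSpace.dist_mk, min_lt_iff] at hya
  have hxi := congrFun hx i
  rcases hya with h | h
  · exact (affineExtension_oddBump_pos hr _ hy h).ne' hxi
  -- Near the antipode of the chosen lift, use that antipode as centre: its odd bump is the negative
  -- of the original one.
  · have h1 := affineExtension_oddBump_pos hr _ hy h
    have h2 : oddBump (-rep i) ε = fun y => -oddBump (rep i) ε y := by
      funext y
      simp only [oddBump, ← RealProjectiveSpace.dist_neg_left, neg_neg]
      ring
    have h3 : affineExtension (oddBump (-rep i) ε) (f x) =
        -affineExtension (oddBump (rep i) ε) (f x) := by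
      rw [h2]
      simp [affineExtension, Finsupp.sum]
    rw [h3] at h1
    simp only [Pi.zero_apply] at hxi
    linarith

/-! ### The upper bound, covering radii and the limit -/

/-- The midpoint of `x` and `-x` is fixed by the involution, so the constant map there is odd. This
also makes the infimum in `oddMapScale` one over a nonempty set. -/
theorem odd_map_pi (n k : ℕ) :
    ∃ f : UnitSphere k → GeometricRealization (vietorisRips (UnitSphere n) Real.pi),
      Continuous f ∧ ∀ x, f (-x) = -f x := by
  classical
  let x : UnitSphere n := ⟨EuclideanSpace.single 0 1, by simp⟩
  have hx : x ≠ -x := fun h => by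
    have := UnitSphere.dist_neg_self x
    rw [← h, dist_self] at this
    exact Real.pi_ne_zero this.symm
  let q : UnitSphere n →₀ ℝ := Finsupp.single x (1 / 2) + Finsupp.single (-x) (1 / 2)
  let p : GeometricRealization (vietorisRips (UnitSphere n) Real.pi) := ⟨q, by
    refine ⟨fun v => ?_, ?_, ?_, ?_⟩
    · simp only [q, Finsupp.add_apply, Finsupp.single_apply]
      split_ifs <;> norm_num
    · rw [Finsupp.sum_add_index' (by simp) (by simp)]
      norm_num
    · refine ⟨x, ?_⟩
      simp [q, hx.symm]
    · exact Metric.diam_le_of_forall_dist_le Real.pi_pos.le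
        fun y _ z _ => UnitSphere.dist_le_pi y z⟩
  refine ⟨fun _ => p, continuous_const, fun _ => Subtype.ext ?_⟩
  change q = q.mapDomain fun x => -x
  simp [q, Finsupp.mapDomain_add, Finsupp.mapDomain_single, add_comm]

theorem oddMapScale_le_pi (n k : ℕ) : oddMapScale n k ≤ Real.pi :=
  csInf_le ⟨0, fun _ h => h.1⟩ ⟨Real.pi_pos.le, odd_map_pi n k⟩

theorem RealProjectiveSpace.exists_cover (n : ℕ) {ε : ℝ} (hε : 0 < ε) :
    ∃ A : Finset (RealProjectiveSpace n), (⋃ a ∈ A, Metric.ball a ε) = Set.univ := by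
  classical
  obtain ⟨t, -, ht, hcov⟩ :=
    finite_cover_balls_of_compact (isCompact_univ (X := UnitSphere n)) hε
  refine ⟨ht.toFinset.image mk, Set.eq_univ_iff_forall.2 fun z => ?_⟩
  induction z using Quotient.inductionOn with | h z => ?_
  obtain ⟨x, hx, hz⟩ := Set.mem_iUnion₂.1 (hcov (Set.mem_univ z))
  refine Set.mem_iUnion₂.2 ⟨mk x, Finset.mem_image_of_mem _ (ht.mem_toFinset.2 hx), ?_⟩
  exact (min_le_left (dist z x) (dist z (-x))).trans_lt hz

theorem coveringRadius_set_nonempty {n k : ℕ} (hk : 1 ≤ k) :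
    {ε : ℝ | 0 < ε ∧ ∃ A : Finset (RealProjectiveSpace n), A.card ≤ k ∧
      (⋃ a ∈ A, Metric.ball a ε) = Set.univ}.Nonempty := by
  let x : UnitSphere n := ⟨EuclideanSpace.single 0 1, by simp⟩
  -- Distances are at most `π`, so one open ball of any larger radius suffices.
  refine ⟨Real.pi + 1, by positivity, {RealProjectiveSpace.mk x}, by simpa using hk, ?_⟩
  rw [Set.eq_univ_iff_forall]
  intro z
  induction z using Quotient.inductionOn with | h z => ?_
  simp only [Finset.mem_singleton, Set.iUnion_iUnion_eq_left]
  change dist (RealProjectiveSpace.mk z) _ < _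
  rw [RealProjectiveSpace.dist_mk]
  linarith [min_le_left (dist z x) (dist z (-x)), UnitSphere.dist_le_pi z x]

theorem le_oddMapScale {n k : ℕ} (hk : 1 ≤ k) :
    Real.pi - 2 * coveringRadius (RealProjectiveSpace n) k ≤ oddMapScale n k := by
  refine le_csInf ⟨Real.pi, Real.pi_pos.le, odd_map_pi n k⟩ ?_
  rintro r ⟨-, f, hf, hodd⟩
  have h : (Real.pi - r) / 2 ≤ coveringRadius (RealProjectiveSpace n) k := by
    refine le_csInf (coveringRadius_set_nonempty hk) ?_
    rintro ε ⟨-, A, hA, hcov⟩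
    linarith [pi_sub_le_of_odd_map hA hcov hf hodd]
  linarith

theorem tendsto_coveringRadius (n : ℕ) :
    Tendsto (fun k => coveringRadius (RealProjectiveSpace n) k) atTop (𝓝 0) := by
  rw [Metric.tendsto_atTop]
  intro ε hε
  obtain ⟨A, hA⟩ := RealProjectiveSpace.exists_cover n (half_pos hε)
  refine ⟨A.card, fun k hk => ?_⟩
  have h1 : coveringRadius (RealProjectiveSpace n) k ≤ ε / 2 :=
    csInf_le ⟨0, fun _ h => h.1.le⟩ ⟨half_pos hε, A, hk, hA⟩
  have h2 : 0 ≤ coveringRadius (RealProjectiveSpace n) k := Real.sInf_nonneg fun _ h => h.1.le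
  rw [Real.dist_eq, sub_zero, abs_of_nonneg h2]
  linarith

theorem mainTheorem4 :
    (∀ n k : ℕ, 1 ≤ n → n ≤ k →
      oddMapScale n k ≥ Real.pi - 2 * coveringRadius (RealProjectiveSpace n) k) ∧
    (∀ n : ℕ, 1 ≤ n → Tendsto (fun k : ℕ => oddMapScale n k) atTop (𝓝 Real.pi)) := by
  refine ⟨fun n k hn hk => le_oddMapScale (hn.trans hk), fun n _ => ?_⟩
  have h : Tendsto (fun k => Real.pi - 2 * coveringRadius (RealProjectiveSpace n) k) atTop
      (𝓝 Real.pi) := by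
    simpa using tendsto_const_nhds.sub ((tendsto_coveringRadius n).const_mul 2)
  exact tendsto_of_tendsto_of_tendsto_of_le_of_le' h tendsto_const_nhds
    ((eventually_ge_atTop 1).mono fun k hk => le_oddMapScale hk)
    (Eventually.of_forall fun k => oddMapScale_le_pi n k)

end
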